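/- Let $\Omega=[0,1]\times[0,1]$ and let $L_2(\Omega)$ be the Hilbert space of fields $w=(u,v):\Omega\to\mathbb C^2$ with $\|w\|^2=\int_\Omega(|u|^2+|v|^2)\,dx\,dy$. Let $\mathcal V$ be the space of $C^\infty$ fields $\varphi:\mathbb R^2\to\mathbb C^2$ that are $1$-periodic in $x$, vanish for $y$ outside some $[a,b]$ with $0<a$, $b<1$, and satisfy $\nabla\cdot\varphi=0$. Let $H$ and $V$ be the closures of $\mathcal V$ in $L_2(\Omega)$ and in $H^1(\Omega)$ (so $H$ consists of the divergence-free $L_2$ fields with zero normal component at the walls $y=0,1$, and $V$ of the divergence-free $H^1$ fields, periodic in $x$ and zero at the walls). For $R>0$ let $$\mathcal L_R w=\tfrac1R\Delta w-(w\cdot\nabla)W-(W\cdot\nabla)w-\nabla p,\qquad W=(y,0),$$ be the linearization at plane Couette flow $W$ of the two-dimensional Navier–Stokes equations in the periodic channel, where the pressure $p$ is such that $\mathcal L_Rw\in H$. Precisely, $\mathcal L_R$ is the unbounded operator in $H$ for which $w\in\operatorname{dom}\mathcal L_R$ and $\mathcal L_Rw=f$ if and only if $w\in V$, $f\in H$ and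 $$\langle\varphi,f\rangle=\tfrac1R\langle\Delta\varphi,w\rangle-\langle\varphi,(v,0)\rangle+\langle y\,\partial_x\varphi,w\rangle\qquad\text{for all }\varphi\in\mathcal V .$$ **Theorem.** Let $R>0$ and let $s\in\mathbb C$ satisfy $\operatorname{Re}s\ge0$ and $|s|\ge2\sqrt2\,(1+\sqrt R)$. Then $s$ belongs to the resolvent set of $\mathcal L_R$, that is, $s\mathcal I-\mathcal L_R:\operatorname{dom}\mathcal L_R\to H$ has a bounded, everywhere defined inverse, and $$\|(s\mathcal I-\mathcal L_R)^{-1}\|^2\le\frac{8}{|s|^2}\,(1+\sqrt R)^2\le1 .$$ -/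

import Mathlib

open MeasureTheory
open scoped ContDiff

noncomputable section

namespace Couette

/-- Values of the (complexified) velocity fields: `ℂ²` with the Euclidean norm. -/
abbrev Vel : Type := EuclideanSpace ℂ (Fin 2)

/-- One period `[0,1] × [0,1]` of the channel; a point is `z = (x, y)`. -/
def cell : Set (ℝ × ℝ) := Set.Icc (0 : ℝ) 1 ×ˢ Set.Icc (0 : ℝ) 1

/-- Lebesgue measure on the period cell. -/
def cellMeasure : Measure (ℝ × ℝ) := volume.restrict cell

/-- The Hilbert space `L₂(Ω)` of complex velocity fields, `‖w‖² = ∫_Ω |u|² + |v|²`. -/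
abbrev L2 : Type := Lp Vel 2 cellMeasure

/-- Smooth velocity fields on the plane. -/
def smoothFields : Submodule ℂ (ℝ × ℝ → Vel) where
  carrier := {φ | ContDiff ℝ ∞ φ}
  zero_mem' := show ContDiff ℝ ∞ (fun _ : ℝ × ℝ => (0 : Vel)) from contDiff_const
  add_mem' := by
    intro f g (hf : ContDiff ℝ ∞ f) (hg : ContDiff ℝ ∞ g)
    exact hf.add hg
  smul_mem' := by
    intro c f (hf : ContDiff ℝ ∞ f)
    exact hf.const_smul c

theorem contDiff_smooth (φ : smoothFields) : ContDiff ℝ ∞ φ.1 := φ.2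

theorem differentiable_smooth (φ : smoothFields) : Differentiable ℝ φ.1 :=
  (contDiff_smooth φ).differentiable (by simp)

/-- The directional derivative `φ ↦ ∂_e φ` of smooth fields. -/
def dirDeriv (e : ℝ × ℝ) : smoothFields →ₗ[ℂ] smoothFields where
  toFun φ := ⟨fun z => fderiv ℝ φ.1 z e,
    show ContDiff ℝ ∞ (fun z => fderiv ℝ φ.1 z e) from
      ((contDiff_smooth φ).fderiv_right (m := ∞) (by simp)).clm_apply contDiff_const⟩
  map_add' φ ψ := by
    ext1
    funext z
    simp [fderiv_add (differentiable_smooth φ z) (differentiable_smooth ψ z)]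
  map_smul' c φ := by
    ext1
    funext z
    simp [fderiv_const_smul (differentiable_smooth φ z) c]

/-- `∂/∂x`, along the channel. -/
def dx : smoothFields →ₗ[ℂ] smoothFields := dirDeriv (1, 0)

/-- `∂/∂y`, across the channel. -/
def dy : smoothFields →ₗ[ℂ] smoothFields := dirDeriv (0, 1)

/-- The (componentwise) Laplacian `Δ = ∂²/∂x² + ∂²/∂y²`. -/
def laplacian : smoothFields →ₗ[ℂ] smoothFields := dx ∘ₗ dx + dy ∘ₗ dy

/-- Transport `(W·∇)φ = y ∂φ/∂x` by the Couette flow `W = (y, 0)`. -/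
def transport : smoothFields →ₗ[ℂ] smoothFields where
  toFun φ := ⟨fun z => z.2 • (dx φ).1 z,
    show ContDiff ℝ ∞ (fun z : ℝ × ℝ => z.2 • (dx φ).1 z) from
      contDiff_snd.smul (contDiff_smooth (dx φ))⟩
  map_add' φ ψ := by
    ext1
    funext z
    simp
  map_smul' c φ := by
    ext1
    funext z
    simp [smul_comm z.2 c]

/-- A smooth field is square integrable on the period cell. -/
theorem memLp_smooth (φ : smoothFields) : MemLp φ.1 2 cellMeasure := by
  have hc : Continuous φ.1 := (contDiff_smooth φ).continuous
  have hK : IsCompact cell := isCompact_Icc.prod isCompact_Icc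
  have : IsFiniteMeasure cellMeasure :=
    ⟨by simpa [cellMeasure] using hK.measure_lt_top⟩
  obtain ⟨C, hC⟩ := hK.exists_bound_of_continuousOn hc.continuousOn
  exact MemLp.of_bound hc.aestronglyMeasurable C
    ((ae_restrict_iff' hK.measurableSet).2 (Filter.Eventually.of_forall hC))

/-- The class in `L₂(Ω)` of a smooth field. -/
def toL2 : smoothFields →ₗ[ℂ] L2 where
  toFun φ := (memLp_smooth φ).toLp φ.1
  map_add' φ ψ := MemLp.toLp_add (memLp_smooth φ) (memLp_smooth ψ)
  map_smul' c φ := MemLp.toLp_const_smul c (memLp_smooth φ)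

/-- Solenoidal test fields: smooth, 1-periodic in `x`, vanishing near the walls `y = 0` and
`y = 1`, and divergence free. -/
def solenoidalTest : Submodule ℂ smoothFields where
  carrier := {φ | (∀ x y : ℝ, φ.1 (x + 1, y) = φ.1 (x, y)) ∧
    (∃ a b : ℝ, 0 < a ∧ b < 1 ∧ ∀ x y : ℝ, y ∉ Set.Icc a b → φ.1 (x, y) = 0) ∧
    ∀ z, (dx φ).1 z 0 + (dy φ).1 z 1 = 0}
  zero_mem' := ⟨by simp, ⟨1 / 2, 1 / 2, by norm_num, by norm_num, by simp⟩, by simp⟩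
  add_mem' := by
    rintro φ ψ ⟨hφ, ⟨a, b, ha, hb, hab⟩, hd⟩ ⟨hψ, ⟨a', b', ha', hb', hab'⟩, hd'⟩
    refine ⟨fun x y => by simp [hφ, hψ],
      ⟨min a a', max b b', lt_min ha ha', max_lt hb hb', fun x y hy => ?_⟩, fun z => ?_⟩
    · have h1 : y ∉ Set.Icc a b := fun h =>
        hy ⟨(min_le_left _ _).trans h.1, h.2.trans (le_max_left _ _)⟩
      have h2 : y ∉ Set.Icc a' b' := fun h =>
        hy ⟨(min_le_right _ _).trans h.1, h.2.trans (le_max_right _ _)⟩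
      simp [hab x y h1, hab' x y h2]
    · have e1 := hd z
      have e2 := hd' z
      simp only [map_add, Submodule.coe_add, Pi.add_apply, PiLp.add_apply]
      linear_combination e1 + e2
  smul_mem' := by
    rintro c φ ⟨hφ, ⟨a, b, ha, hb, hab⟩, hd⟩
    refine ⟨fun x y => by simp [hφ], ⟨a, b, ha, hb, fun x y hy => by simp [hab x y hy]⟩,
      fun z => ?_⟩
    have e1 := hd z
    simp only [map_smul, Submodule.coe_smul, Pi.smul_apply, PiLp.smul_apply, smul_eq_mul]
    linear_combination c * e1

/-- The solenoidal space `H`: the closure in `L₂(Ω)` of the solenoidal test fields (the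
divergence free fields with zero normal component at the walls). -/
def solenoidalL2 : Submodule ℂ L2 := (solenoidalTest.map toL2).topologicalClosure

/-- The triples `(w, ∂w/∂x, ∂w/∂y)` with `w` in the `H¹`-closure of the solenoidal test
fields. -/
def solenoidalH1Graph : Submodule ℂ (L2 × L2 × L2) :=
  (solenoidalTest.map
    (toL2.prod ((toL2 ∘ₗ dx).prod (toL2 ∘ₗ dy)))).topologicalClosure

/-- The space `V`: the closure in `H¹` of the solenoidal test fields (divergence free `H¹`
fields, periodic in `x` and zero at the walls). -/
def solenoidalH1 : Submodule ℂ L2 := solenoidalH1Graph.map (LinearMap.fst ℂ L2 (L2 × L2))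

/-- The matrix of `(w·∇)W` for `W = (y, 0)`: `(u, v) ↦ (v, 0)`. -/
def shearMatrix : Vel →L[ℂ] Vel :=
  LinearMap.toContinuousLinearMap (Matrix.toEuclideanLin !![0, 1; 0, 0])

/-- `w ↦ (w·∇)W = (v, 0)` on `L₂(Ω)`, for the Couette flow `W = (y, 0)`. -/
def shear : L2 →L[ℂ] L2 := shearMatrix.compLpL 2 cellMeasure

/-- The graph of the linearized operator. A pair `(w, f)` of solenoidal fields belongs to it
when `w` lies in `V` and
`f = (1/R) Δw - (w·∇)W - (W·∇)w - ∇p` for some pressure `p`, in the sense of distributions.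
As usual the pressure is eliminated by testing against solenoidal fields only, and the
derivatives of `w` are moved to the test field (`(W·∇)` is skew-adjoint). -/
def operatorGraph (R : ℝ) : Submodule ℂ (solenoidalL2 × solenoidalL2) where
  carrier := {q | (q.1 : L2) ∈ solenoidalH1 ∧ ∀ φ ∈ solenoidalTest,
    inner ℂ (toL2 φ) (q.2 : L2) =
      ((1 / R : ℝ) : ℂ) * inner ℂ (toL2 (laplacian φ)) (q.1 : L2)
        - inner ℂ (toL2 φ) (shear q.1)
        + inner ℂ (toL2 (transport φ)) (q.1 : L2)}
  zero_mem' := ⟨by simp, fun φ _ => by simp⟩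
  add_mem' := by
    rintro p q ⟨hp, hp'⟩ ⟨hq, hq'⟩
    refine ⟨by simpa using add_mem hp hq, fun φ hφ => ?_⟩
    have e1 := hp' φ hφ
    have e2 := hq' φ hφ
    simp only [Prod.fst_add, Prod.snd_add, Submodule.coe_add, map_add, inner_add_right]
    linear_combination e1 + e2
  smul_mem' := by
    rintro c q ⟨hq, hq'⟩
    refine ⟨by simpa using Submodule.smul_mem _ c hq, fun φ hφ => ?_⟩
    have e1 := hq' φ hφ
    simp only [Prod.smul_fst, Prod.smul_snd, Submodule.coe_smul, map_smul, inner_smul_right]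
    linear_combination c * e1

/-- The graph is single valued, because the test fields are dense in `H`. -/
theorem operatorGraph_functional (R : ℝ) (q : solenoidalL2 × solenoidalL2)
    (hq : q ∈ operatorGraph R) (h0 : q.1 = 0) : q.2 = 0 := by
  obtain ⟨-, h⟩ := hq
  have hz : ∀ g ∈ solenoidalTest.map toL2, inner ℂ g (q.2 : L2) = 0 := by
    rintro _ ⟨φ, hφ, rfl⟩
    have := h φ hφ
    simpa [h0] using this
  have hmem : (q.2 : L2) ∈ (solenoidalTest.map toL2)ᗮ :=
    (Submodule.mem_orthogonal _ _).2 hz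
  rw [← Submodule.orthogonal_closure] at hmem
  have := (Submodule.mem_orthogonal _ _).1 hmem q.2 q.2.2
  exact Subtype.ext (inner_self_eq_zero.1 this)

/-- The linearized operator `L_R w = (1/R) Δw - (w·∇)W - (W·∇)w - ∇p`, an unbounded operator
in the Hilbert space `H` of solenoidal fields. -/
def linearizedOperator (R : ℝ) : solenoidalL2 →ₗ.[ℂ] solenoidalL2 :=
  (operatorGraph R).toLinearPMap

/-- The graph of `linearizedOperator R` is `operatorGraph R`. -/
theorem graph_linearizedOperator (R : ℝ) :
    (linearizedOperator R).graph = operatorGraph R :=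
  Submodule.toLinearPMap_graph_eq _ (operatorGraph_functional R)

/-- `T = (s I - L)⁻¹`: `T` is a bounded, everywhere defined two-sided inverse of
`s I - L : dom L → X`. -/
def IsResolvent {X : Type*} [NormedAddCommGroup X] [NormedSpace ℂ X]
    (L : X →ₗ.[ℂ] X) (s : ℂ) (T : X →L[ℂ] X) : Prop :=
  (∀ f : X, ∃ h : T f ∈ L.domain, s • T f - L ⟨T f, h⟩ = f) ∧
    ∀ w : L.domain, T (s • (w : X) - L w) = w

end Couette

end

noncomputable section

namespace Couette

/-! ### Integration by parts on the period cell -/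

/-! The proof is an energy estimate followed by Lax–Milgram. For `w` in `V`, with `X = ‖w‖` and `D =
‖∇w‖`, the form of `s I - L_R` at `w` is `a = s X² + b + D²/R - c`, where the shear term satisfies
`|b| ≤ X²` and the transport term `c` is purely imaginary with `|c| ≤ D X`. Since `Re s ≥ 0`, the
real part of `a` controls both `D²/R` and `Re s · X²`, and the imaginary part then controls `|Im s|
X²`. Put `|s| = 2√2 k (1 + √R)` with `k ≥ 1`. If `|a| < k X²`, these bounds force `Re s < 2k` and
`|Im s| < 2k(1 + √R)`, which makes `|s|` too small (`energy_bound`). Hence `k X² ≤ |a|`; together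
with the bound on `D` this makes the form coercive on `V` (`isUnit_formOperator`). Solutions of the
weak problem are exactly graph elements of `L_R` (`mem_operatorGraph_iff`), and `k X² ≤ |⟨w, f⟩|`
bounds the resolvent by `1/k`. -/

theorem cell_eq_Icc : cell = Set.Icc ((0, 0) : ℝ × ℝ) (1, 1) := by
  rw [cell, Set.Icc_prod_Icc]

theorem isCompact_cell : IsCompact cell := isCompact_Icc.prod isCompact_Icc

/-- The divergence theorem on the period cell, in the case of vanishing flux. -/
theorem integral_cell_divergence_eq_zero {F G : ℝ × ℝ → ℂ} (hF : ContDiff ℝ 1 F)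
    (hG : ContDiff ℝ 1 G) (hper : ∀ y, F (1, y) = F (0, y)) (hwall : ∀ x, G (x, 1) = G (x, 0)) :
    ∫ z, (fderiv ℝ F z (1, 0) + fderiv ℝ G z (0, 1)) ∂cellMeasure = 0 := by
  have hcont : Continuous fun z => fderiv ℝ F z (1, 0) + fderiv ℝ G z (0, 1) :=
    ((hF.continuous_fderiv (by simp)).clm_apply continuous_const).add
      ((hG.continuous_fderiv (by simp)).clm_apply continuous_const)
  have key := integral_divergence_prod_Icc_of_hasFDerivAt_of_le F G (fderiv ℝ F) (fderiv ℝ G)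
    (0, 0) (1, 1) (by simp) hF.continuous.continuousOn hG.continuous.continuousOn
    (fun z _ => (hF.differentiable (by simp) z).hasFDerivAt)
    (fun z _ => (hG.differentiable (by simp) z).hasFDerivAt)
    (hcont.continuousOn.integrableOn_compact isCompact_Icc)
  rw [← cell_eq_Icc] at key
  simpa [cellMeasure, hper, hwall] using key

theorem integral_cell_dx_eq_zero {h : ℝ × ℝ → ℂ} (hh : ContDiff ℝ 1 h)
    (hper : ∀ y, h (1, y) = h (0, y)) : ∫ z, fderiv ℝ h z (1, 0) ∂cellMeasure = 0 := by
  simpa using integral_cell_divergence_eq_zero hh (G := fun _ => 0) contDiff_const hper (by simp)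

theorem integral_cell_dy_eq_zero {h : ℝ × ℝ → ℂ} (hh : ContDiff ℝ 1 h)
    (hwall : ∀ x, h (x, 1) = h (x, 0)) : ∫ z, fderiv ℝ h z (0, 1) ∂cellMeasure = 0 := by
  simpa using integral_cell_divergence_eq_zero (F := fun _ => 0) contDiff_const hh (by simp) hwall

theorem inner_toL2 (φ ψ : smoothFields) :
    inner ℂ (toL2 φ) (toL2 ψ) = ∫ z, inner ℂ (φ.1 z) (ψ.1 z) ∂cellMeasure := by
  rw [L2.inner_def]
  refine integral_congr_ae ?_
  filter_upwards [(memLp_smooth φ).coeFn_toLp, (memLp_smooth ψ).coeFn_toLp] with z h1 h2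
  change inner ℂ ((memLp_smooth φ).toLp φ.1 z) ((memLp_smooth ψ).toLp ψ.1 z) = _
  rw [h1, h2]

theorem contDiff_inner_smooth (φ ψ : smoothFields) :
    ContDiff ℝ ∞ fun z => (inner ℂ (φ.1 z) (ψ.1 z) : ℂ) :=
  (contDiff_smooth φ).inner ℂ (contDiff_smooth ψ)

theorem integrable_inner_smooth (φ ψ : smoothFields) :
    Integrable (fun z => (inner ℂ (φ.1 z) (ψ.1 z) : ℂ)) cellMeasure :=
  (contDiff_inner_smooth φ ψ).continuous.continuousOn.integrableOn_compact isCompact_cell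

theorem inner_dirDeriv_add (e : ℝ × ℝ) (φ ψ : smoothFields) :
    inner ℂ (toL2 (dirDeriv e φ)) (toL2 ψ) + inner ℂ (toL2 φ) (toL2 (dirDeriv e ψ)) =
      ∫ z, fderiv ℝ (fun z => (inner ℂ (φ.1 z) (ψ.1 z) : ℂ)) z e ∂cellMeasure := by
  rw [inner_toL2, inner_toL2,
    ← integral_add (integrable_inner_smooth _ _) (integrable_inner_smooth _ _)]
  refine integral_congr_ae (Filter.Eventually.of_forall fun z => ?_)
  have := fderiv_inner_apply ℂ (differentiable_smooth φ z) (differentiable_smooth ψ z) e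
  simp only [this]
  exact add_comm _ _

theorem inner_dx_left {φ ψ : smoothFields} (hφ : ∀ x y : ℝ, φ.1 (x + 1, y) = φ.1 (x, y))
    (hψ : ∀ x y : ℝ, ψ.1 (x + 1, y) = ψ.1 (x, y)) :
    inner ℂ (toL2 (dx φ)) (toL2 ψ) = -inner ℂ (toL2 φ) (toL2 (dx ψ)) := by
  refine eq_neg_of_add_eq_zero_left ((inner_dirDeriv_add (1, 0) φ ψ).trans ?_)
  refine integral_cell_dx_eq_zero ((contDiff_inner_smooth φ ψ).of_le (by simp)) fun y => ?_
  have h1 := hφ 0 y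
  have h2 := hψ 0 y
  rw [zero_add] at h1 h2
  rw [h1, h2]

/-- The boundary term is a product, so it is enough that one factor vanishes on the walls. -/
theorem inner_dy_left {φ ψ : smoothFields} (h0 : ∀ x : ℝ, ψ.1 (x, 0) = 0)
    (h1 : ∀ x : ℝ, ψ.1 (x, 1) = 0) :
    inner ℂ (toL2 (dy φ)) (toL2 ψ) = -inner ℂ (toL2 φ) (toL2 (dy ψ)) := by
  refine eq_neg_of_add_eq_zero_left ((inner_dirDeriv_add (0, 1) φ ψ).trans ?_)
  refine integral_cell_dy_eq_zero ((contDiff_inner_smooth φ ψ).of_le (by simp)) fun x => ?_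
  simp [h0, h1]

/-! ### Identities for solenoidal test fields -/

theorem dx_periodic {φ : smoothFields} (hφ : ∀ x y : ℝ, φ.1 (x + 1, y) = φ.1 (x, y)) (x y : ℝ) :
    (dx φ).1 (x + 1, y) = (dx φ).1 (x, y) := by
  have h : (fun z : ℝ × ℝ => φ.1 (z + (1, 0))) = φ.1 := by
    funext z
    have hz : z + (1, 0) = (z.1 + 1, z.2) := by ext <;> simp
    rw [hz, hφ]
  have := fderiv_comp_add_right (𝕜 := ℝ) (f := φ.1) (x := (x, y)) ((1 : ℝ), (0 : ℝ))
  rw [h] at this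
  change fderiv ℝ φ.1 (x + 1, y) (1, 0) = fderiv ℝ φ.1 (x, y) (1, 0)
  rw [this]
  simp

theorem inner_laplacian_left {φ ψ : smoothFields} (hφ : φ ∈ solenoidalTest)
    (hψ : ψ ∈ solenoidalTest) :
    inner ℂ (toL2 (laplacian φ)) (toL2 ψ) =
      -(inner ℂ (toL2 (dx φ)) (toL2 (dx ψ)) + inner ℂ (toL2 (dy φ)) (toL2 (dy ψ))) := by
  obtain ⟨pφ, -, -⟩ := hφ
  obtain ⟨pψ, ⟨a, b, ha, hb, hab⟩, -⟩ := hψ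
  have e1 := inner_dx_left (φ := dx φ) (dx_periodic pφ) pψ
  have e2 := inner_dy_left (φ := dy φ) (ψ := ψ) (fun x => hab x 0 fun h => ha.not_ge h.1)
    (fun x => hab x 1 fun h => hb.not_ge h.2)
  have e3 : laplacian φ = dx (dx φ) + dy (dy φ) := rfl
  rw [e3, map_add, inner_add_left, e1, e2]
  ring

/-- Transport by the Couette flow is skew-symmetric. -/
theorem re_inner_transport_self {φ : smoothFields} (hφ : φ ∈ solenoidalTest) :
    (inner ℂ (toL2 (transport φ)) (toL2 φ) : ℂ).re = 0 := by
  obtain ⟨pφ, -, -⟩ := hφ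
  -- The field `y φ` need not be divergence free, but integration by parts in `x` uses only
  -- periodicity, and `∂/∂x` commutes with multiplication by `y`.
  let ψ : smoothFields := ⟨fun z => z.2 • φ.1 z,
    show ContDiff ℝ ∞ (fun z : ℝ × ℝ => z.2 • φ.1 z) from contDiff_snd.smul (contDiff_smooth φ)⟩
  have hψ : dx ψ = transport φ := by
    ext1
    funext z
    change fderiv ℝ (fun z : ℝ × ℝ => z.2 • φ.1 z) z (1, 0) = z.2 • fderiv ℝ φ.1 z (1, 0)
    rw [fderiv_fun_smul differentiableAt_snd (differentiable_smooth φ z)]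
    simp [fderiv_snd]
  have e1 : inner ℂ (toL2 (transport φ)) (toL2 φ) = inner ℂ (toL2 (dx φ)) (toL2 ψ) := by
    rw [inner_toL2, inner_toL2]
    refine integral_congr_ae (Filter.Eventually.of_forall fun z => ?_)
    change inner ℂ (z.2 • (dx φ).1 z) (φ.1 z) = inner ℂ ((dx φ).1 z) (z.2 • φ.1 z)
    rw [RCLike.real_smul_eq_coe_smul (K := ℂ), RCLike.real_smul_eq_coe_smul (K := ℂ),
      inner_smul_left, inner_smul_right, RCLike.conj_ofReal]
  have e2 := inner_dx_left pφ (ψ := ψ) (fun x y => congrArg (y • ·) (pφ x y))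
  -- Now `e2` has the form `ζ = -conj ζ`, so `ζ` is purely imaginary.
  rw [hψ, ← e1, ← inner_conj_symm (toL2 φ)] at e2
  have := congrArg Complex.re e2
  simp only [Complex.neg_re, Complex.conj_re] at this
  linarith

/-! ### Multiplication by the height -/

theorem ae_cellMeasure_mem : ∀ᵐ z ∂cellMeasure, z ∈ cell :=
  ae_restrict_mem isCompact_cell.measurableSet

theorem memLp_height : MemLp (fun z : ℝ × ℝ => (z.2 : ℂ)) ⊤ cellMeasure := by
  refine memLp_top_of_bound (by fun_prop) 1 ?_
  filter_upwards [ae_cellMeasure_mem] with z hz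
  rw [Complex.norm_real, Real.norm_of_nonneg hz.2.1]
  exact hz.2.2

/-- Multiplication by the height `y` above the lower wall, on `L₂(Ω)`. -/
def mulHeight : L2 →L[ℂ] L2 :=
  (ContinuousLinearMap.lsmul ℂ ℂ).holderL cellMeasure ⊤ 2 2 memLp_height.toLp

theorem coeFn_mulHeight (w : L2) : mulHeight w =ᵐ[cellMeasure] fun z => (z.2 : ℂ) • w z := by
  filter_upwards [(ContinuousLinearMap.lsmul ℂ ℂ).coeFn_holder (r := 2) memLp_height.toLp w,
    memLp_height.coeFn_toLp] with z h1 h2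
  refine h1.trans ?_
  rw [h2]
  rfl

theorem norm_mulHeight_le (w : L2) : ‖mulHeight w‖ ≤ ‖w‖ := by
  refine Lp.norm_le_norm_of_ae_le ?_
  filter_upwards [coeFn_mulHeight w, ae_cellMeasure_mem] with z h1 hz
  rw [h1, norm_smul, Complex.norm_real, Real.norm_of_nonneg hz.2.1]
  exact mul_le_of_le_one_left (norm_nonneg _) hz.2.2

/-- Writing transport as a bounded operator applied to `∂/∂x` lets its identities pass from test
fields to all of `V` by continuity. -/
theorem toL2_transport (φ : smoothFields) : toL2 (transport φ) = mulHeight (toL2 (dx φ)) := by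
  refine Lp.ext ?_
  filter_upwards [coeFn_mulHeight (toL2 (dx φ)), (memLp_smooth (dx φ)).coeFn_toLp,
    (memLp_smooth (transport φ)).coeFn_toLp] with z h1 h2 h3
  refine h3.trans (Eq.trans ?_ h1.symm)
  change z.2 • (dx φ).1 z = (z.2 : ℂ) • ((memLp_smooth (dx φ)).toLp (dx φ).1 z)
  rw [h2]
  rfl

theorem norm_shear_le (w : L2) : ‖shear w‖ ≤ ‖w‖ := by
  have hM : ‖shearMatrix‖ ≤ 1 := by
    refine ContinuousLinearMap.opNorm_le_bound _ zero_le_one fun x => ?_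
    rw [one_mul]
    refine le_of_sq_le_sq ?_ (norm_nonneg _)
    rw [EuclideanSpace.norm_sq_eq, EuclideanSpace.norm_sq_eq]
    simp [shearMatrix, Matrix.toLpLin_apply, dotProduct, Fin.sum_univ_two]
  calc ‖shear w‖ ≤ ‖shear‖ * ‖w‖ := shear.le_opNorm w
    _ ≤ 1 * ‖w‖ := by
      gcongr
      exact (ContinuousLinearMap.norm_compLpL_le shearMatrix).trans hM
    _ = ‖w‖ := one_mul _

/-! ### The form domain as a Hilbert space -/

/-- To prove a closed property of all triples `(w, ∂w/∂x, ∂w/∂y)` with `w ∈ V` it suffices to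
prove it for solenoidal test fields. -/
theorem solenoidalH1Graph_induction {p : L2 × L2 × L2 → Prop} (hp : IsClosed {t | p t})
    (h : ∀ φ ∈ solenoidalTest, p (toL2 φ, toL2 (dx φ), toL2 (dy φ)))
    {t : L2 × L2 × L2} (ht : t ∈ solenoidalH1Graph) : p t := by
  refine closure_minimal ?_ hp ht
  rintro _ ⟨φ, hφ, rfl⟩
  exact h φ hφ

theorem mem_solenoidalH1Graph {φ : smoothFields} (hφ : φ ∈ solenoidalTest) :
    (toL2 φ, toL2 (dx φ), toL2 (dy φ)) ∈ solenoidalH1Graph :=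
  subset_closure ⟨φ, hφ, rfl⟩

theorem fst_mem_solenoidalL2 {t : L2 × L2 × L2} (ht : t ∈ solenoidalH1Graph) :
    t.1 ∈ solenoidalL2 := by
  refine solenoidalH1Graph_induction (p := fun t => t.1 ∈ solenoidalL2) ?_ ?_ ht
  · exact (Submodule.isClosed_topologicalClosure _).preimage continuous_fst
  · exact fun φ hφ => subset_closure ⟨φ, hφ, rfl⟩

/-- Triples of `L₂` fields with the Hilbert norm. -/
abbrev Triples : Type := PiLp 2 fun _ : Fin 3 => L2

/-- The components of a triple. -/
def components : Triples →L[ℂ] L2 × L2 × L2 :=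
  (PiLp.proj 2 (fun _ : Fin 3 => L2) 0).prod
    ((PiLp.proj 2 (fun _ : Fin 3 => L2) 1).prod (PiLp.proj 2 (fun _ : Fin 3 => L2) 2))

/-- The space `V` with its `H¹` Hilbert norm, as a space of triples `(w, ∂w/∂x, ∂w/∂y)`. -/
def formDomain : Submodule ℂ Triples := solenoidalH1Graph.comap components.toLinearMap

instance completeSpace_formDomain : CompleteSpace formDomain :=
  ((Submodule.isClosed_topologicalClosure _).preimage components.continuous).completeSpace_coe

/-- The inclusion `w ↦ w` of `V` in `L₂(Ω)`. -/
def val : formDomain →L[ℂ] L2 := (PiLp.proj 2 (fun _ : Fin 3 => L2) 0).comp formDomain.subtypeL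

/-- `∂/∂x : V → L₂(Ω)`. -/
def gradX : formDomain →L[ℂ] L2 :=
  (PiLp.proj 2 (fun _ : Fin 3 => L2) 1).comp formDomain.subtypeL

/-- `∂/∂y : V → L₂(Ω)`. -/
def gradY : formDomain →L[ℂ] L2 :=
  (PiLp.proj 2 (fun _ : Fin 3 => L2) 2).comp formDomain.subtypeL

theorem triple_mem (w : formDomain) : (val w, gradX w, gradY w) ∈ solenoidalH1Graph := w.2

theorem exists_triple_eq {t : L2 × L2 × L2} (ht : t ∈ solenoidalH1Graph) :
    ∃ w : formDomain, (val w, gradX w, gradY w) = t :=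
  ⟨⟨WithLp.toLp 2 ![t.1, t.2.1, t.2.2], ht⟩, rfl⟩

theorem norm_sq_formDomain (w : formDomain) :
    ‖w‖ ^ 2 = ‖val w‖ ^ 2 + ‖gradX w‖ ^ 2 + ‖gradY w‖ ^ 2 := by
  change ‖(w : Triples)‖ ^ 2 = _
  rw [PiLp.norm_sq_eq_of_L2, Fin.sum_univ_three]
  rfl

theorem val_mem_solenoidalL2 (w : formDomain) : val w ∈ solenoidalL2 :=
  fst_mem_solenoidalL2 (triple_mem w)

theorem mem_solenoidalH1_iff {w : L2} : w ∈ solenoidalH1 ↔ ∃ u : formDomain, val u = w := by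
  constructor
  · rintro ⟨t, ht, rfl⟩
    obtain ⟨u, hu⟩ := exists_triple_eq ht
    exact ⟨u, congrArg Prod.fst hu⟩
  · rintro ⟨u, rfl⟩
    exact ⟨_, triple_mem u, rfl⟩

theorem formDomain_induction {p : L2 → L2 → L2 → Prop}
    (hp : IsClosed {t : L2 × L2 × L2 | p t.1 t.2.1 t.2.2})
    (h : ∀ φ ∈ solenoidalTest, p (toL2 φ) (toL2 (dx φ)) (toL2 (dy φ))) (w : formDomain) :
    p (val w) (gradX w) (gradY w) :=
  solenoidalH1Graph_induction (p := fun t => p t.1 t.2.1 t.2.2) hp h (triple_mem w)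

theorem exists_formDomain_eq {φ : smoothFields} (hφ : φ ∈ solenoidalTest) :
    ∃ w : formDomain, val w = toL2 φ ∧ gradX w = toL2 (dx φ) ∧ gradY w = toL2 (dy φ) := by
  obtain ⟨w, hw⟩ := exists_triple_eq (mem_solenoidalH1Graph hφ)
  simp only [Prod.mk.injEq] at hw
  exact ⟨w, hw⟩

theorem re_inner_mulHeight_self (w : formDomain) :
    (inner ℂ (mulHeight (gradX w)) (val w) : ℂ).re = 0 := by
  refine formDomain_induction (p := fun u ux _ => (inner ℂ (mulHeight ux) u : ℂ).re = 0) ?_ ?_ w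
  · exact isClosed_eq (by fun_prop) continuous_const
  · intro φ hφ
    rw [← toL2_transport]
    exact re_inner_transport_self hφ

/-- Links the two weak formulations: the graph puts both derivatives on the test field, the form
puts one on each side. -/
theorem inner_laplacian_val {φ : smoothFields} (hφ : φ ∈ solenoidalTest) (w : formDomain) :
    inner ℂ (toL2 (laplacian φ)) (val w) =
      -(inner ℂ (toL2 (dx φ)) (gradX w) + inner ℂ (toL2 (dy φ)) (gradY w) : ℂ) := by
  refine formDomain_induction (p := fun u ux uy => inner ℂ (toL2 (laplacian φ)) u =
      -(inner ℂ (toL2 (dx φ)) ux + inner ℂ (toL2 (dy φ)) uy : ℂ)) ?_ ?_ w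
  · exact isClosed_eq (by fun_prop) (by fun_prop)
  · exact fun ψ hψ => inner_laplacian_left hφ hψ

/-! ### The form operator -/

open ContinuousLinearMap (adjoint) in
/-- The bounded operator on `V` representing the sesquilinear form of `s I - L_R`. -/
def formOperator (R : ℝ) (s : ℂ) : formDomain →L[ℂ] formDomain :=
  adjoint val ∘L (s • val + shear ∘L val)
    + (adjoint gradX ∘L (((1 / R : ℝ) : ℂ) • gradX)
      + adjoint gradY ∘L (((1 / R : ℝ) : ℂ) • gradY))
    - adjoint (mulHeight ∘L gradX) ∘L val

theorem inner_formOperator (R : ℝ) (s : ℂ) (v w : formDomain) :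
    inner ℂ v (formOperator R s w) = s * inner ℂ (val v) (val w)
      + inner ℂ (val v) (shear (val w))
      + ((1 / R : ℝ) : ℂ) * (inner ℂ (gradX v) (gradX w) + inner ℂ (gradY v) (gradY w))
      - inner ℂ (mulHeight (gradX v)) (val w) := by
  simp only [formOperator, sub_apply, add_apply,
    ContinuousLinearMap.comp_apply, smul_apply, inner_sub_right,
    inner_add_right, inner_smul_right, ContinuousLinearMap.adjoint_inner_right, mul_add]

/-- Membership in the graph of the operator, through the form operator. -/
theorem mem_operatorGraph_iff (R : ℝ) (s : ℂ) (u : formDomain) (f : solenoidalL2) :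
    ((⟨val u, val_mem_solenoidalL2 u⟩, s • ⟨val u, val_mem_solenoidalL2 u⟩ - f) :
        solenoidalL2 × solenoidalL2) ∈ operatorGraph R ↔
      formOperator R s u = ContinuousLinearMap.adjoint val (f : L2) := by
  -- Against a single test field the graph equation and the form equation are rearrangements of each
  -- other; density then extends the latter to all of `V`.
  have key : ∀ φ ∈ solenoidalTest, ∀ v : formDomain,
      val v = toL2 φ → gradX v = toL2 (dx φ) → gradY v = toL2 (dy φ) →
      (inner ℂ (toL2 φ) (s • val u - (f : L2)) =
        ((1 / R : ℝ) : ℂ) * inner ℂ (toL2 (laplacian φ)) (val u)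
          - inner ℂ (toL2 φ) (shear (val u)) + inner ℂ (toL2 (transport φ)) (val u) ↔
      inner ℂ v (formOperator R s u) = inner ℂ (val v) (f : L2)) := by
    intro φ hφ v h0 h1 h2
    rw [inner_formOperator, inner_laplacian_val hφ, toL2_transport, h0, h1, h2,
      inner_sub_right, inner_smul_right]
    constructor <;> intro h <;> linear_combination h
  constructor
  · rintro ⟨-, h⟩
    refine ext_inner_left ℂ fun v => ?_
    rw [ContinuousLinearMap.adjoint_inner_right, inner_formOperator]
    refine formDomain_induction (p := fun z zx zy => s * inner ℂ z (val u)
      + inner ℂ z (shear (val u))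
      + ((1 / R : ℝ) : ℂ) * (inner ℂ zx (gradX u) + inner ℂ zy (gradY u))
      - inner ℂ (mulHeight zx) (val u) = inner ℂ z (f : L2)) ?_ ?_ v
    · exact isClosed_eq (by fun_prop) (by fun_prop)
    · intro φ hφ
      obtain ⟨w, h0, h1, h2⟩ := exists_formDomain_eq hφ
      have := (key φ hφ w h0 h1 h2).1 (h φ hφ)
      rwa [inner_formOperator, h0, h1, h2] at this
  · intro h
    refine ⟨mem_solenoidalH1_iff.2 ⟨u, rfl⟩, fun φ hφ => ?_⟩
    obtain ⟨w, h0, h1, h2⟩ := exists_formDomain_eq hφ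
    refine (key φ hφ w h0 h1 h2).2 ?_
    rw [h, ContinuousLinearMap.adjoint_inner_right]

/-! ### Coercivity -/

/-- The energy inequality: `X`, `D` are the norms of a field and of its gradient, `b` and `c` the
contributions of shear and transport. -/
theorem energy_bound {R k X D σ τ F : ℝ} {b c : ℂ} (hR : 0 < R) (hX : 0 ≤ X)
    (hσ : 0 ≤ σ) (hk : 1 ≤ k) (hs : σ ^ 2 + τ ^ 2 = 8 * k ^ 2 * (1 + √R) ^ 2)
    (hb : ‖b‖ ≤ X ^ 2) (hc : ‖c‖ ≤ D * X) (hre : |σ * X ^ 2 + b.re + 1 / R * D ^ 2| ≤ F)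
    (him : |τ * X ^ 2 + b.im - c.im| ≤ F) :
    k * X ^ 2 ≤ F ∧ D ^ 2 ≤ R * (F + X ^ 2) := by
  have hbre := abs_le.1 ((Complex.abs_re_le_norm b).trans hb)
  have hbim := abs_le.1 ((Complex.abs_im_le_norm b).trans hb)
  have hcim := abs_le.1 ((Complex.abs_im_le_norm c).trans hc)
  have hre' := abs_le.1 hre
  have him' := abs_le.1 him
  have hσX : 0 ≤ σ * X ^ 2 := by positivity
  have hDR : D ^ 2 ≤ R * (F + X ^ 2) := by
    have h : 1 / R * D ^ 2 ≤ F + X ^ 2 := by linarith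
    rwa [one_div, inv_mul_le_iff₀ hR] at h
  refine ⟨?_, hDR⟩
  by_contra! hF
  -- If `X = 0`, then `F < k X² = 0`, contradicting `F ≥ 0`.
  have hXpos : 0 < X := by
    rcases hX.eq_or_lt with h | h
    · subst h
      have := (abs_nonneg _).trans hre
      norm_num at hF
      linarith
    · exact h
  have hX2 : 0 < X ^ 2 := by positivity
  set r := √R with hr
  have hr0 : 0 ≤ r := Real.sqrt_nonneg _
  have hrR : r ^ 2 = R := Real.sq_sqrt hR.le
  have hFX : F + X ^ 2 < 2 * k * X ^ 2 := by nlinarith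
  have hD2 : D ≤ 2 * k * r * X := by
    refine le_of_sq_le_sq ?_ (by positivity)
    calc D ^ 2 ≤ r ^ 2 * (F + X ^ 2) := by rw [hrR]; exact hDR
      -- Since `k ≥ 1`, the factor `2k` may be enlarged to the perfect square `4k²`.
      _ ≤ r ^ 2 * (4 * k ^ 2 * X ^ 2) := by
        gcongr
        nlinarith
      _ = (2 * k * r * X) ^ 2 := by ring
  have hDR0 : 0 ≤ 1 / R * D ^ 2 := by positivity
  have hσ1 : σ < 2 * k := by
    have : σ * X ^ 2 < 2 * k * X ^ 2 := by linarith
    exact lt_of_mul_lt_mul_right this hX2.le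
  have hDX : D * X ≤ 2 * k * r * X ^ 2 := by nlinarith
  have hτ1 : |τ| < 2 * k * (1 + r) := by
    rw [abs_lt]
    constructor
    · have : -(2 * k * (1 + r)) * X ^ 2 < τ * X ^ 2 := by linarith
      exact lt_of_mul_lt_mul_right this hX2.le
    · have : τ * X ^ 2 < 2 * k * (1 + r) * X ^ 2 := by linarith
      exact lt_of_mul_lt_mul_right this hX2.le
  have hτ2 : τ ^ 2 < (2 * k * (1 + r)) ^ 2 := sq_lt_sq' (abs_lt.1 hτ1).1 (abs_lt.1 hτ1).2
  have hσ2 : σ ^ 2 ≤ (2 * k * (1 + r)) ^ 2 := by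
    refine pow_le_pow_left₀ hσ (hσ1.le.trans ?_) 2
    nlinarith
  -- Adding the two squares gives `σ² + τ² < 8k²(1 + r)²`, against `hs`.
  nlinarith

theorem formOperator_lower_bounds {R : ℝ} (hR : 0 < R) {s : ℂ} (hs : 0 ≤ s.re) {k : ℝ}
    (hk : 1 ≤ k) (hsk : ‖s‖ ^ 2 = 8 * k ^ 2 * (1 + √R) ^ 2) (w : formDomain) :
    k * ‖val w‖ ^ 2 ≤ ‖inner ℂ w (formOperator R s w)‖ ∧
      ‖gradX w‖ ^ 2 + ‖gradY w‖ ^ 2 ≤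
        R * (‖inner ℂ w (formOperator R s w)‖ + ‖val w‖ ^ 2) := by
  set a : ℂ := inner ℂ w (formOperator R s w) with ha
  set b : ℂ := inner ℂ (val w) (shear (val w)) with hb
  set c : ℂ := inner ℂ (mulHeight (gradX w)) (val w) with hc
  set D : ℝ := √(‖gradX w‖ ^ 2 + ‖gradY w‖ ^ 2) with hD
  have hD2 : D ^ 2 = ‖gradX w‖ ^ 2 + ‖gradY w‖ ^ 2 := Real.sq_sqrt (by positivity)
  have hcre : c.re = 0 := re_inner_mulHeight_self w
  have haeq : a = s * (‖val w‖ ^ 2 : ℝ) + b + ((1 / R * D ^ 2 : ℝ) : ℂ) - c := by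
    rw [ha, inner_formOperator, inner_self_eq_norm_sq_to_K, inner_self_eq_norm_sq_to_K,
      inner_self_eq_norm_sq_to_K, hD2]
    push_cast
    rfl
  have hbn : ‖b‖ ≤ ‖val w‖ ^ 2 := by
    refine (norm_inner_le_norm _ _).trans ?_
    rw [sq]
    gcongr
    exact norm_shear_le _
  have hcn : ‖c‖ ≤ D * ‖val w‖ := by
    refine (norm_inner_le_norm _ _).trans ?_
    gcongr
    refine (norm_mulHeight_le _).trans (Real.le_sqrt_of_sq_le ?_)
    linarith [sq_nonneg ‖gradY w‖]
  have hre : a.re = s.re * ‖val w‖ ^ 2 + b.re + 1 / R * D ^ 2 := by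
    rw [haeq, Complex.sub_re, Complex.add_re, Complex.add_re, Complex.re_mul_ofReal,
      Complex.ofReal_re, hcre, sub_zero]
  have him : a.im = s.im * ‖val w‖ ^ 2 + b.im - c.im := by
    rw [haeq, Complex.sub_im, Complex.add_im, Complex.add_im, Complex.im_mul_ofReal,
      Complex.ofReal_im, add_zero]
  rw [← hD2]
  refine energy_bound hR (norm_nonneg _) hs hk ?_ hbn hcn
    (hre ▸ Complex.abs_re_le_norm a) (him ▸ Complex.abs_im_le_norm a)
  rw [← hsk, Complex.sq_norm, Complex.normSq_apply]
  ring

/-- Lax–Milgram. With `F = |⟨w, A w⟩|`, where `A` is the form operator, `X² ≤ F` and `D² ≤ R(F + X²)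
≤ 2RF`, so `‖w‖² ≤ (1 + 2R) F`. -/
theorem isUnit_formOperator {R : ℝ} (hR : 0 < R) {s : ℂ} (hs : 0 ≤ s.re) {k : ℝ}
    (hk : 1 ≤ k) (hsk : ‖s‖ ^ 2 = 8 * k ^ 2 * (1 + √R) ^ 2) : IsUnit (formOperator R s) := by
  have hc : 0 < 1 / (1 + 2 * R) := by positivity
  refine ContinuousLinearMap.isUnit_of_forall_le_norm_inner_map _ (c := ⟨_, hc.le⟩) hc fun w => ?_
  obtain ⟨h1, h2⟩ := formOperator_lower_bounds hR hs hk hsk w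
  rw [norm_inner_symm, norm_sq_formDomain]
  change _ * (1 / (1 + 2 * R)) ≤ _
  rw [mul_one_div, div_le_iff₀ (by positivity)]
  have h3 : ‖val w‖ ^ 2 ≤ ‖inner ℂ w (formOperator R s w)‖ :=
    (le_mul_of_one_le_left (by positivity) hk).trans h1
  have h4 := mul_le_mul_of_nonneg_left h3 hR.le
  linarith

/-! ### The resolvent -/

theorem exists_resolvent {R : ℝ} (hR : 0 < R) {s : ℂ} (hs : 0 ≤ s.re) {k : ℝ}
    (hk : 1 ≤ k) (hsk : ‖s‖ ^ 2 = 8 * k ^ 2 * (1 + √R) ^ 2) :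
    ∃ T : solenoidalL2 →L[ℂ] solenoidalL2,
      IsResolvent (linearizedOperator R) s T ∧ ‖T‖ ≤ 1 / k := by
  obtain ⟨A, hA⟩ := isUnit_formOperator hR hs hk hsk
  have hAB : ∀ u, formOperator R s ((↑A⁻¹ : formDomain →L[ℂ] formDomain) u) = u := fun u => by
    rw [← hA, ← mul_apply_eq_comp, Units.mul_inv, one_apply_eq_self]
  have hBA : ∀ u, (↑A⁻¹ : formDomain →L[ℂ] formDomain) (formOperator R s u) = u := fun u => by
    rw [← hA, ← mul_apply_eq_comp, Units.inv_mul, one_apply_eq_self]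
  let S : solenoidalL2 →L[ℂ] formDomain :=
    (↑A⁻¹ : formDomain →L[ℂ] formDomain) ∘L ContinuousLinearMap.adjoint val ∘L
      solenoidalL2.subtypeL
  have hS : ∀ f : solenoidalL2,
      formOperator R s (S f) = ContinuousLinearMap.adjoint val (f : L2) := fun f => hAB _
  let T : solenoidalL2 →L[ℂ] solenoidalL2 :=
    (val ∘L S).codRestrict solenoidalL2 fun f => val_mem_solenoidalL2 _
  refine ⟨T, ⟨fun f => ?_, fun w => ?_⟩, ?_⟩
  · have hmem : (T f, s • T f - f) ∈ (linearizedOperator R).graph := by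
      rw [graph_linearizedOperator]
      exact (mem_operatorGraph_iff R s (S f) f).2 (hS f)
    obtain ⟨x, hx1, hx2⟩ := (LinearPMap.mem_graph_iff _).1 hmem
    have hx1' : (x : solenoidalL2) = T f := hx1
    refine ⟨hx1' ▸ x.2, ?_⟩
    have hx : (⟨T f, hx1' ▸ x.2⟩ : (linearizedOperator R).domain) = x := Subtype.ext hx1'.symm
    rw [hx, hx2]
    simp
  · have hmem := (linearizedOperator R).mem_graph w
    rw [graph_linearizedOperator] at hmem
    obtain ⟨u, hu⟩ := mem_solenoidalH1_iff.1 hmem.1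
    have hu' : (⟨val u, val_mem_solenoidalL2 u⟩ : solenoidalL2) = w := Subtype.ext hu
    -- For `f = s w - L w` the second component `s w - f` is `L w`, so membership in the graph
    -- becomes the form equation, which `u` solves uniquely.
    have h := (mem_operatorGraph_iff R s u (s • (w : solenoidalL2) - linearizedOperator R w)).1
      (by rw [hu', sub_sub_cancel]; exact hmem)
    have hSu : S (s • (w : solenoidalL2) - linearizedOperator R w) = u :=
      (congrArg (↑A⁻¹ : formDomain →L[ℂ] formDomain) h.symm).trans (hBA u)
    refine Subtype.ext ?_
    change val (S _) = _
    rw [hSu, hu]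
  · have hk0 : 0 < k := by linarith
    refine ContinuousLinearMap.opNorm_le_bound _ (by positivity) fun f => ?_
    have h1 := (formOperator_lower_bounds hR hs hk hsk (S f)).1
    rw [hS, ContinuousLinearMap.adjoint_inner_right] at h1
    have h2 := h1.trans (norm_inner_le_norm (𝕜 := ℂ) (val (S f)) (f : L2))
    change ‖val (S f)‖ ≤ 1 / k * ‖(f : L2)‖
    rw [one_div, ← div_eq_inv_mul, le_div_iff₀ hk0]
    -- From `k ‖T f‖² ≤ ‖T f‖ ‖f‖` one factor cancels unless `T f = 0`.
    rcases (norm_nonneg (val (S f))).eq_or_lt with h | h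
    · rw [← h, zero_mul]
      exact norm_nonneg _
    · refine le_of_mul_le_mul_left ?_ h
      linarith

end Couette

end

/-- For `R > 0`, `Re s ≥ 0` and `|s| ≥ 2√2(1 + √R)`, the resolvent of the linearized Couette
operator exists and `‖(s I - L_R)⁻¹‖² ≤ 8(1 + √R)²/|s|² ≤ 1`. -/
theorem theorem1 (R : ℝ) (hR : 0 < R) (s : ℂ) (hs : 0 ≤ s.re)
    (hs' : 2 * Real.sqrt 2 * (1 + Real.sqrt R) ≤ ‖s‖) :
    ∃ T : Couette.solenoidalL2 →L[ℂ] Couette.solenoidalL2,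
      Couette.IsResolvent (Couette.linearizedOperator R) s T ∧
      ‖T‖ ^ 2 ≤ 8 / ‖s‖ ^ 2 * (1 + Real.sqrt R) ^ 2 ∧
      8 / ‖s‖ ^ 2 * (1 + Real.sqrt R) ^ 2 ≤ 1 := by
  have hm : 0 < 2 * √2 * (1 + √R) := by positivity
  have hm2 : (2 * √2 * (1 + √R)) ^ 2 = 8 * (1 + √R) ^ 2 := by
    rw [mul_pow, mul_pow, Real.sq_sqrt zero_le_two]
    norm_num
  have hs0 : 0 < ‖s‖ := hm.trans_le hs'
  -- This ratio is the `k` of the energy estimate; the claimed bound is exactly `(1/k)²`.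
  have hk : 1 ≤ ‖s‖ / (2 * √2 * (1 + √R)) := (one_le_div hm).2 hs'
  have hrhs : 8 / ‖s‖ ^ 2 * (1 + √R) ^ 2 = (1 / (‖s‖ / (2 * √2 * (1 + √R)))) ^ 2 := by
    rw [one_div_div, div_pow, hm2]
    ring
  obtain ⟨T, hT, hn⟩ := Couette.exists_resolvent hR hs hk (by
    rw [div_pow, hm2]
    field_simp)
  refine ⟨T, hT, ?_, ?_⟩
  · rw [hrhs]
    exact pow_le_pow_left₀ T.opNorm_nonneg hn 2
  · rw [hrhs]
    refine pow_le_one₀ (by positivity) ?_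
    rw [one_div]
    exact inv_le_one_of_one_le₀ hk
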